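/- Let $k \ge 1$ be an integer. Let $\mathrm{P}\Gamma_N$ be the image in $\mathrm{PSL}_2(\mathbb{Z})$ of the principal congruence subgroup $\Gamma_N \subseteq \mathrm{SL}_2(\mathbb{Z})$ of level $N$, and let $x$ and $y$ be the classes of $\begin{pmatrix}1&2\\0&1\end{pmatrix}$ and $\begin{pmatrix}1&0\\2&1\end{pmatrix}$ in the group $\mathrm{P}\Gamma_2/\mathrm{P}\Gamma_6$ (of order 12). Let $X$ be the origami (square-tiled surface) with the 48 unit squares $(A,h)$, $A \in \mathrm{P}\Gamma_2/\mathrm{P}\Gamma_6$, $h \in \{1,2,3,4\}$, in which the right neighbour $r$ and the upper neighbour $u$ of a square are $$r:\quad (A,1)\mapsto(A,2),\quad (A,2)\mapsto(Ay^{-1},1),\quad (A,3)\mapsto(A,4),\quad (A,4)\mapsto(Ay,3),$$ $$u:\quad (A,1)\mapsto(Ay,3),\quad (A,2)\mapsto(Ay^{-1},4),\quad (A,3)\mapsto(Ax^{-1},1),\quad (A,4)\mapsto(Ax,2).$$ Let $Y = Y_k$ be the following origami, a $2k$-fold cyclic cover of $X$. Its squares are $(A,h,j)$ with $(A,h)$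 a square of $X$ and $j \in \mathbb{Z}/2k\mathbb{Z}$. The right neighbour of $(A,h,j)$ is $(r(A,h),\, j+d(A,h))$ and its upper neighbour is $(u(A,h),\, j)$, where $$d = +1 \text{ on } (y^{-1}x,3),\ (y^{-1},1),\ (y,3),\ (yx^{-1},1),\qquad d = -1 \text{ on } (y^{-1}x,1),\ (y^{-1},3),\ (y,1),\ (yx^{-1},3),$$ and $d = 0$ on all other squares. (The surface $Y$ is closed and connected, of genus $24k+1$.) Endow $Y$ with the translation structure pulled back from $\mathbb{R}^2/\mathbb{Z}^2$. **Proposition.** The Veech group of $Y$, i.e. the group of derivatives of all orientation preserving affine homeomorphisms of $Y$, is $\mathrm{SL}_2(\mathbb{Z})$. -/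

import Mathlib

open scoped Topology MatrixGroups

noncomputable section

/-- Gluing data of a square-tiled surface: finitely many unit squares, the right edge of `s` being
glued to the left edge of `right s`, and the upper edge of `s` to the lower edge of `up s`. -/
structure SquareTiling where
  Square : Type
  finite : Finite Square
  right : Equiv.Perm Square
  up : Equiv.Perm Square

namespace SquareTiling

variable (O : SquareTiling)

/-- The disjoint union of the closed unit squares. -/
abbrev Pieces : Type := Σ _ : O.Square, unitInterval × unitInterval

/-- The elementary edge identifications. -/
inductive Glue : O.Pieces → O.Pieces → Prop
  | right (s : O.Square) (t : unitInterval) : Glue ⟨s, (1, t)⟩ ⟨O.right s, (0, t)⟩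
  | up (s : O.Square) (t : unitInterval) : Glue ⟨s, (t, 1)⟩ ⟨O.up s, (t, 0)⟩

/-- The surface obtained from the squares by gluing their edges, with the quotient topology
(`Quot` takes the generated equivalence relation). -/
def Surface : Type := Quot O.Glue

instance : TopologicalSpace O.Surface := inferInstanceAs (TopologicalSpace (Quot O.Glue))

/-- The covering of the torus `ℝ² / ℤ²` that maps every square onto the unit square,
ramified at most over the origin. -/
def toTorus : O.Surface → Fin 2 → UnitAddCircle :=
  Quot.lift (fun z i => (((![z.2.1, z.2.2] i : unitInterval) : ℝ) : UnitAddCircle)) (by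
    have h : ((1 : ℝ) : UnitAddCircle) = ((0 : ℝ) : UnitAddCircle) := by
      rw [AddCircle.coe_period]; rfl
    rintro _ _ (⟨s, t⟩ | ⟨s, t⟩) <;> funext i <;> fin_cases i <;> simp)

/-- The charts of the translation structure pulled back from `ℝ² / ℤ²`: the homeomorphisms from an
open subset of the surface to an open subset of `ℝ²` that lift the covering of the torus. -/
def IsTranslationChart (φ : OpenPartialHomeomorph O.Surface (Fin 2 → ℝ)) : Prop :=
  ∀ x ∈ φ.source, (fun i => (φ x i : UnitAddCircle)) = O.toTorus x

/-- The regular points are those around which there is a translation chart;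
the other points are the cone point singularities (cone angle `2πm` with `m ≥ 2`). -/
def IsRegular (x : O.Surface) : Prop :=
  ∃ φ, O.IsTranslationChart φ ∧ x ∈ φ.source

/-- `f` is an affine homeomorphism with derivative `A`: it preserves the set of singularities and
its complement, and in translation charts it is locally of the form `v ↦ A v + b`. -/
def IsAffineWithDerivative (f : O.Surface ≃ₜ O.Surface) (A : Matrix (Fin 2) (Fin 2) ℝ) : Prop :=
  (∀ x, O.IsRegular (f x) ↔ O.IsRegular x) ∧
    ∀ φ ψ, O.IsTranslationChart φ → O.IsTranslationChart ψ →
      ∀ x₀ ∈ φ.source, f x₀ ∈ ψ.source →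
        ∃ b : Fin 2 → ℝ, ∀ᶠ x in 𝓝 x₀, ψ (f x) = A.mulVec (φ x) + b

variable {O}

theorem IsTranslationChart.eventually_eq_add
    {φ ψ : OpenPartialHomeomorph O.Surface (Fin 2 → ℝ)}
    (hφ : O.IsTranslationChart φ) (hψ : O.IsTranslationChart ψ)
    {x₀ : O.Surface} (h₁ : x₀ ∈ φ.source) (h₂ : x₀ ∈ ψ.source) :
    ∃ b : Fin 2 → ℝ, ∀ᶠ x in 𝓝 x₀, ψ x = φ x + b := by
  refine ⟨ψ x₀ - φ x₀, ?_⟩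
  have hc : ContinuousAt (fun x => ψ x - φ x) x₀ :=
    (ψ.continuousAt h₂).sub (φ.continuousAt h₁)
  have hball := hc.eventually (Metric.ball_mem_nhds _ (zero_lt_one (α := ℝ)))
  filter_upwards [hball, φ.open_source.mem_nhds h₁, ψ.open_source.mem_nhds h₂] with x hx hx1 hx2
  have key : ∀ y ∈ φ.source, y ∈ ψ.source → ∀ i, ∃ n : ℤ, (n : ℝ) = ψ y i - φ y i := by
    intro y h1 h2 i
    have h := (congrFun ((hψ y h2).trans (hφ y h1).symm) i)
    have h' : ((ψ y i - φ y i : ℝ) : UnitAddCircle) = 0 := by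
      rw [AddCircle.coe_sub]; exact sub_eq_zero.2 h
    obtain ⟨n, hn⟩ := (AddCircle.coe_eq_zero_iff (1 : ℝ)).1 h'
    exact ⟨n, by simpa using hn⟩
  funext i
  obtain ⟨n, hn⟩ := key x hx1 hx2 i
  obtain ⟨m, hm⟩ := key x₀ h₁ h₂ i
  have hd : dist (ψ x i - φ x i) (ψ x₀ i - φ x₀ i) < 1 :=
    lt_of_le_of_lt (dist_le_pi_dist (ψ x - φ x) (ψ x₀ - φ x₀) i) hx
  rw [← hn, ← hm, Real.dist_eq] at hd
  have : n = m := by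
    have h3 : |n - m| < 1 := by exact_mod_cast hd
    have := Int.abs_lt_one_iff.1 h3
    omega
  subst this
  simp only [Pi.add_apply, Pi.sub_apply]
  linarith

variable (O)

/-- The Veech group: the group of derivatives of the orientation preserving affine
homeomorphisms, as a subgroup of `GL₂(ℝ)`. -/
def veechGroup : Subgroup (GL (Fin 2) ℝ) where
  carrier := {A | 0 < (A : Matrix (Fin 2) (Fin 2) ℝ).det ∧
    ∃ f : O.Surface ≃ₜ O.Surface, O.IsAffineWithDerivative f A}
  one_mem' := by
    refine ⟨by simp, Homeomorph.refl _, fun x => Iff.rfl, fun φ ψ hφ hψ x₀ h₁ h₂ => ?_⟩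
    simpa using hφ.eventually_eq_add hψ h₁ h₂
  mul_mem' := by
    rintro A B ⟨hA, f, hf, hf'⟩ ⟨hB, g, hg, hg'⟩
    refine ⟨by simpa using mul_pos hA hB, g.trans f,
      fun x => (hf (g x)).trans (hg x), fun φ ψ hφ hψ x₀ h₁ h₂ => ?_⟩
    obtain ⟨χ, hχ, h₃⟩ := (hg x₀).2 ⟨φ, hφ, h₁⟩
    obtain ⟨b, hb⟩ := hg' φ χ hφ hχ x₀ h₁ h₃
    obtain ⟨c, hc⟩ := hf' χ ψ hχ hψ (g x₀) h₃ h₂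
    refine ⟨(A : Matrix (Fin 2) (Fin 2) ℝ).mulVec b + c, ?_⟩
    filter_upwards [hb, g.continuous.continuousAt.eventually hc] with x h h'
    simp only [Homeomorph.trans_apply, Units.val_mul]
    rw [h', h, Matrix.mulVec_add, Matrix.mulVec_mulVec, add_assoc]
  inv_mem' := by
    rintro A ⟨hA, f, hf, hf'⟩
    refine ⟨?_, f.symm, fun x => by simpa using (hf (f.symm x)).symm,
      fun φ ψ hφ hψ x₀ h₁ h₂ => ?_⟩
    · rw [Matrix.coe_units_inv, Matrix.det_nonsing_inv, Ring.inverse_eq_inv']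
      exact inv_pos.2 hA
    · obtain ⟨b, hb⟩ := hf' ψ φ hψ hφ (f.symm x₀) h₂ (by simpa using h₁)
      refine ⟨-((A⁻¹ : GL (Fin 2) ℝ) : Matrix (Fin 2) (Fin 2) ℝ).mulVec b, ?_⟩
      filter_upwards [f.symm.continuous.continuousAt.eventually hb] with x h
      rw [Homeomorph.apply_symm_apply] at h
      rw [h, Matrix.mulVec_add, Matrix.mulVec_mulVec, ← Units.val_mul, inv_mul_cancel,
        Units.val_one, Matrix.one_mulVec, add_neg_cancel_right]

/-- The cyclic cover made of `n` copies of the tiling indexed by `ℤ/n`: the right edge of the copy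
`(s, j)` of the square `s` is glued to `(right s, j + d s)`; the upper edges stay in their copy. -/
def cyclicCover (n : ℕ) [NeZero n] (d : O.Square → ℤ) : SquareTiling where
  Square := O.Square × ZMod n
  finite := by
    have := O.finite
    infer_instance
  right :=
    { toFun := fun s => (O.right s.1, s.2 + (d s.1 : ZMod n))
      invFun := fun s => (O.right.symm s.1, s.2 - (d (O.right.symm s.1) : ZMod n))
      left_inv := fun s => by simp
      right_inv := fun s => by simp }
  up := O.up.prodCongr (Equiv.refl _)

end SquareTiling

/-- `PΓ_N`, the image in `PSL₂(ℤ)` of the principal congruence subgroup of level `N`. -/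
def PGamma (N : ℕ) : Subgroup PSL(2, ℤ) :=
  (CongruenceSubgroup.Gamma N).map (QuotientGroup.mk' _)

instance (N : ℕ) : (PGamma N).Normal :=
  Subgroup.Normal.map (CongruenceSubgroup.Gamma_normal N) _ (QuotientGroup.mk'_surjective _)

/-- The quotient group `PΓ₂ / PΓ₆`. -/
abbrev PGammaQuot : Type := PGamma 2 ⧸ (PGamma 6).subgroupOf (PGamma 2)

/-- `x = T²`. -/
def xMat : SL(2, ℤ) := ⟨!![1, 2; 0, 1], by simp⟩

/-- `y = L²`. -/
def yMat : SL(2, ℤ) := ⟨!![1, 0; 2, 1], by simp⟩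

theorem xMat_mem : xMat ∈ CongruenceSubgroup.Gamma 2 := by
  rw [CongruenceSubgroup.Gamma_mem]; decide

theorem yMat_mem : yMat ∈ CongruenceSubgroup.Gamma 2 := by
  rw [CongruenceSubgroup.Gamma_mem]; decide

/-- The class of `x` in `PΓ₂ / PΓ₆`. -/
def xQ : PGammaQuot :=
  QuotientGroup.mk ⟨QuotientGroup.mk' _ xMat, Subgroup.mem_map_of_mem _ xMat_mem⟩

/-- The class of `y` in `PΓ₂ / PΓ₆`. -/
def yQ : PGammaQuot :=
  QuotientGroup.mk ⟨QuotientGroup.mk' _ yMat, Subgroup.mem_map_of_mem _ yMat_mem⟩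

theorem finite_PGammaQuot : Finite PGammaQuot := by
  have : (PGamma 6).FiniteIndex :=
    ⟨fun h => (inferInstance : (CongruenceSubgroup.Gamma 6).FiniteIndex).index_ne_zero
      (Nat.eq_zero_of_zero_dvd (h ▸ Subgroup.index_map_dvd (CongruenceSubgroup.Gamma 6)
        (QuotientGroup.mk'_surjective (Subgroup.center SL(2, ℤ)))))⟩
  infer_instance

/-- The origami `X` of 48 squares. The square `(A, h)` with `h ∈ {1, 2, 3, 4}` is
`(A, h - 1)` here, with second entry in `Fin 4 = {0, 1, 2, 3}`. -/
def origamiX : SquareTiling where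
  Square := PGammaQuot × Fin 4
  finite := by
    have := finite_PGammaQuot
    infer_instance
  right :=
    { toFun := fun s => match s with
        | (A, 0) => (A, 1)
        | (A, 1) => (A * yQ⁻¹, 0)
        | (A, 2) => (A, 3)
        | (A, 3) => (A * yQ, 2)
      invFun := fun s => match s with
        | (A, 0) => (A * yQ, 1)
        | (A, 1) => (A, 0)
        | (A, 2) => (A * yQ⁻¹, 3)
        | (A, 3) => (A, 2)
      left_inv := by rintro ⟨A, h⟩; fin_cases h <;> simp
      right_inv := by rintro ⟨A, h⟩; fin_cases h <;> simp }
  up :=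
    { toFun := fun s => match s with
        | (A, 0) => (A * yQ, 2)
        | (A, 1) => (A * yQ⁻¹, 3)
        | (A, 2) => (A * xQ⁻¹, 0)
        | (A, 3) => (A * xQ, 1)
      invFun := fun s => match s with
        | (A, 0) => (A * xQ, 2)
        | (A, 1) => (A * xQ⁻¹, 3)
        | (A, 2) => (A * yQ⁻¹, 0)
        | (A, 3) => (A * yQ, 1)
      left_inv := by rintro ⟨A, h⟩; fin_cases h <;> simp
      right_inv := by rintro ⟨A, h⟩; fin_cases h <;> simp }

open Classical in
/-- The slits: the change of the copy when the right edge of a square of `X` is crossed.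
It is `1` at the slits with an arrow pointing upwards, `-1` at those with an arrow pointing
downwards, and `0` at all other vertical edges. With `A₄ = y⁻¹x`, `A₅ = y⁻¹`, `A₆ = y`,
`A₇ = yx⁻¹`, the squares on the left of a slit are the `(A_i, 1)` and `(A_i, 3)`, `4 ≤ i ≤ 7`. -/
def slitDrift (s : PGammaQuot × Fin 4) : ℤ :=
  if s = (yQ⁻¹ * xQ, 2) ∨ s = (yQ⁻¹, 0) ∨ s = (yQ, 2) ∨ s = (yQ * xQ⁻¹, 0) then 1
  else if s = (yQ⁻¹ * xQ, 0) ∨ s = (yQ⁻¹, 2) ∨ s = (yQ, 0) ∨ s = (yQ * xQ⁻¹, 2) then -1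
  else 0

/-- The origami `Y`: `2k` copies of `X`, slit and cyclically reglued. -/
def origamiY (k : ℕ) [NeZero k] : SquareTiling :=
  origamiX.cyclicCover (2 * k) slitDrift

end

/-! The Veech group is bounded from both sides.

To contain `SL₂(ℤ)` it suffices to realise the generators S and T. An affine homeomorphism over S or
T is a permutation of the squares that intertwines the neighbour maps in the way the rotation or the
shear moves edges. Such permutations exist on X. They lift to Y because d, read as a cocycle with
value d on steps to the right and 0 on steps upwards, is pulled back to −d plus the coboundary of an
integer function c; the lift is (s, j) ↦ (σ s, c s − j). The identities hold over ℤ, so one finite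
check serves every k. It is carried out after identifying PΓ₂/PΓ₆ with `SL₂(𝔽₃)`/±1
(`gammaQuotMap_eq_iff`).

To be contained in `SL₂(ℤ)`: all points not over the origin are regular, so singularities lie over
the origin, and an affine f permutes them. An edge e joining two singularities is sent to a straight
path with holonomy A e between points over the origin, whence A e ∈ ℤ² (`exists_int_of_segment`).
One horizontal and one vertical edge make A integral; so is A⁻¹, and positivity of the determinant
gives det A = 1. `veechGroup_eq_range` combines both bounds. -/

noncomputable section

open Set Filter Topology

/-! ### Coordinates on the glued surface and maps out of it -/

namespace SquareTiling

variable (O : SquareTiling)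

/-- The point with coordinates `(x, y)` of the square `s` (coordinates are clamped to `[0, 1]`). -/
def pt (s : O.Square) (x y : ℝ) : O.Surface :=
  Quot.mk _ ⟨s, (projIcc 0 1 zero_le_one x, projIcc 0 1 zero_le_one y)⟩

theorem pt_right (s : O.Square) (y : ℝ) : O.pt s 1 y = O.pt (O.right s) 0 y := by
  have := Quot.sound (Glue.right (O := O) s (projIcc 0 1 zero_le_one y))
  simpa [pt] using! this

theorem pt_up (s : O.Square) (x : ℝ) : O.pt s x 1 = O.pt (O.up s) x 0 := by
  have := Quot.sound (Glue.up (O := O) s (projIcc 0 1 zero_le_one x))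
  simpa [pt] using! this

theorem mk_eq_pt (s : O.Square) (p : unitInterval × unitInterval) :
    (Quot.mk _ ⟨s, p⟩ : O.Surface) = O.pt s p.1 p.2 := by
  simp only [pt, projIcc_val]

theorem isOpen_iff_pt {U : Set O.Surface} :
    IsOpen U ↔ ∀ s, IsOpen {p : unitInterval × unitInterval | O.pt s p.1 p.2 ∈ U} := by
  simp only [← mk_eq_pt]
  exact (isQuotientMap_quot_mk (r := O.Glue)).isOpen_preimage.symm.trans isOpen_sigma_iff

theorem exists_eq_pt (z : O.Surface) :
    ∃ s, ∃ x ∈ Icc (0 : ℝ) 1, ∃ y ∈ Icc (0 : ℝ) 1, z = O.pt s x y := by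
  obtain ⟨⟨s, p⟩, rfl⟩ := Quot.exists_rep z
  exact ⟨s, _, p.1.2, _, p.2.2, O.mk_eq_pt s p⟩

theorem continuous_pt (s : O.Square) : Continuous fun p : ℝ × ℝ => O.pt s p.1 p.2 := by
  have h : Continuous fun p : ℝ × ℝ => (⟨s, (projIcc 0 1 zero_le_one p.1,
      projIcc 0 1 zero_le_one p.2)⟩ : O.Pieces) :=
    continuous_sigmaMk.comp (by fun_prop)
  exact continuous_quot_mk.comp h

theorem toTorus_pt (s : O.Square) {x y : ℝ} (hx : x ∈ Icc (0 : ℝ) 1) (hy : y ∈ Icc (0 : ℝ) 1) :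
    O.toTorus (O.pt s x y) = fun i => ((![x, y] i : ℝ) : UnitAddCircle) := by
  funext i
  fin_cases i
  · simp [toTorus, pt, projIcc_of_mem _ hx]
  · simp [toTorus, pt, projIcc_of_mem _ hy]

theorem continuous_toTorus : Continuous O.toTorus := by
  refine continuous_quot_lift _ (continuous_sigma fun s => continuous_pi fun i => ?_)
  refine (AddCircle.continuous_mk' 1).comp ?_
  fin_cases i <;> simp <;> fun_prop

section Lift

variable {O} {α : Type*} (F : O.Square → ℝ → ℝ → α)
  (hr : ∀ s, ∀ y ∈ Icc (0 : ℝ) 1, F s 1 y = F (O.right s) 0 y)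
  (hu : ∀ s, ∀ x ∈ Icc (0 : ℝ) 1, F s x 1 = F (O.up s) x 0)

/-- The map on the surface given by a compatible family of maps on the squares. -/
def lift : O.Surface → α :=
  Quot.lift (fun z => F z.1 z.2.1 z.2.2) (by
    rintro _ _ (⟨s, t⟩ | ⟨s, t⟩)
    · simpa using hr s t t.2
    · simpa using hu s t t.2)

theorem lift_pt (s : O.Square) {x y : ℝ} (hx : x ∈ Icc (0 : ℝ) 1) (hy : y ∈ Icc (0 : ℝ) 1) :
    lift F hr hu (O.pt s x y) = F s x y := by
  simp [lift, pt, projIcc_of_mem _ hx, projIcc_of_mem _ hy]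

theorem continuous_lift [TopologicalSpace α]
    (hF : ∀ s, Continuous fun p : ℝ × ℝ => F s p.1 p.2) : Continuous (lift F hr hu) := by
  refine continuous_quot_lift _ (continuous_sigma fun s => ?_)
  exact (hF s).comp (f := fun p : unitInterval × unitInterval => ((p.1 : ℝ), (p.2 : ℝ)))
    (by fun_prop)

end Lift

/-- Interior points of the squares have a unique representative. -/
theorem pt_injective {s s' : O.Square} {x y x' y' : ℝ} (hx : x ∈ Ioo (0 : ℝ) 1)
    (hy : y ∈ Ioo (0 : ℝ) 1) (hx' : x' ∈ Ioo (0 : ℝ) 1) (hy' : y' ∈ Ioo (0 : ℝ) 1)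
    (h : O.pt s x y = O.pt s' x' y') : s = s' := by
  -- The indicator of the point descends to the surface: an interior point never lies on an edge, so
  -- both sides of each gluing condition are false.
  let F : O.Square → ℝ → ℝ → Prop := fun q a b => q = s ∧ a = x ∧ b = y
  have hr : ∀ q, ∀ b ∈ Icc (0 : ℝ) 1, F q 1 b = F (O.right q) 0 b := fun q b _ => by
    simp [F, hx.1.ne, hx.2.ne']
  have hu : ∀ q, ∀ a ∈ Icc (0 : ℝ) 1, F q a 1 = F (O.up q) a 0 := fun q b _ => by
    simp [F, hy.1.ne, hy.2.ne']
  have h1 := lift_pt F hr hu s (Ioo_subset_Icc_self hx) (Ioo_subset_Icc_self hy)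
  have h2 := lift_pt F hr hu s' (Ioo_subset_Icc_self hx') (Ioo_subset_Icc_self hy')
  rw [h, h2] at h1
  have : F s' x' y' := by rw [h1]; exact ⟨rfl, rfl, rfl⟩
  exact this.1.symm

/-- Down, left, up, right is one full turn around the lower left vertex of s, so the square reached
shares that vertex with s. -/
theorem pt_corner (s : O.Square) :
    O.pt (O.right (O.up (O.right.symm (O.up.symm s)))) 0 0 = O.pt s 0 0 := by
  rw [← O.pt_right, ← O.pt_up]
  have h1 := O.pt_right (O.right.symm (O.up.symm s)) 1
  have h2 := O.pt_up (O.up.symm s) 0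
  rw [Equiv.apply_symm_apply] at h1 h2
  rw [h1, h2]

/-! ### Charts across vertical edges, and cone points -/

section Strip

/-- The rectangle `[0, 2] × [0, 1]` formed by a square and its right neighbour. -/
def strip (s : O.Square) (x y : ℝ) : O.Surface :=
  if x ≤ 1 then O.pt s x y else O.pt (O.right s) (x - 1) y

variable {O}

theorem strip_of_le {s : O.Square} {x y : ℝ} (h : x ≤ 1) : O.strip s x y = O.pt s x y := if_pos h

theorem strip_of_ge {s : O.Square} {x y : ℝ} (h : 1 ≤ x) :
    O.strip s x y = O.pt (O.right s) (x - 1) y := by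
  rcases h.eq_or_lt with rfl | h
  · rw [strip_of_le le_rfl, pt_right, sub_self]
  · exact if_neg h.not_ge

variable (O)

theorem continuous_strip (s : O.Square) : Continuous fun p : ℝ × ℝ => O.strip s p.1 p.2 := by
  refine Continuous.if_le (O.continuous_pt s)
    ((O.continuous_pt (O.right s)).comp (f := fun p : ℝ × ℝ => (p.1 - 1, p.2)) (by fun_prop))
    (by fun_prop) continuous_const fun p hp => ?_
  rw [hp, sub_self, pt_right]

theorem toTorus_strip (s : O.Square) {x y : ℝ} (hx : x ∈ Icc (0 : ℝ) 2) (hy : y ∈ Icc (0 : ℝ) 1) :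
    O.toTorus (O.strip s x y) = fun i => ((![x, y] i : ℝ) : UnitAddCircle) := by
  rcases le_total x 1 with h | h
  · rw [strip_of_le h, toTorus_pt _ _ ⟨hx.1, h⟩ hy]
  · rw [strip_of_ge h, toTorus_pt _ _ ⟨by linarith, by linarith [hx.2]⟩ hy]
    funext i
    fin_cases i
    · simp only [Fin.zero_eta, Matrix.cons_val_zero, AddCircle.coe_sub]
      rw [AddCircle.coe_period, sub_zero]
    · rfl

/-- An open unit square in the middle of a strip. -/
def window (a : ℝ) : Set (Fin 2 → ℝ) := {w | a < w 0 ∧ w 0 < a + 1 ∧ 0 < w 1 ∧ w 1 < 1}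

theorem isOpen_window (a : ℝ) : IsOpen (window a) := by
  have h0 : Continuous fun w : Fin 2 → ℝ => w 0 := continuous_apply 0
  have h1 : Continuous fun w : Fin 2 → ℝ => w 1 := continuous_apply 1
  exact (isOpen_lt continuous_const h0).inter ((isOpen_lt h0 continuous_const).inter
    ((isOpen_lt continuous_const h1).inter (isOpen_lt h1 continuous_const)))

/-- The piecewise description of the image of a subset of a window. -/
def windowPred (s : O.Square) (V : Set (Fin 2 → ℝ)) (q : O.Square) (x y : ℝ) : Prop :=
  q = s ∧ ![x, y] ∈ V ∨ q = O.right s ∧ ![x + 1, y] ∈ V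

variable {O} {s : O.Square} {a : ℝ} (ha : a ∈ Icc (0 : ℝ) 1) {V : Set (Fin 2 → ℝ)}
  (hV : V ⊆ window a)

include ha hV

/-- Only the edge between s and its right neighbour can meet V: since 0 ≤ a ≤ 1, the abscissas 0 and
2 lie outside the window. -/
theorem windowPred_right (q : O.Square) (y : ℝ) :
    O.windowPred s V q 1 y = O.windowPred s V (O.right q) 0 y := by
  have h1 : ∀ z, ![1 + 1, z] ∉ V := fun z h => by
    have := (hV h).2.1
    simp at this
    linarith [ha.2]
  have h2 : ∀ z, ![0, z] ∉ V := fun z h => by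
    have := (hV h).1
    simp at this
    linarith [ha.1]
  simp [windowPred, h1, h2]

omit ha in
theorem windowPred_up (q : O.Square) (x : ℝ) :
    O.windowPred s V q x 1 = O.windowPred s V (O.up q) x 0 := by
  have h1 : ∀ z, ![z, 1] ∉ V := fun z h => by
    have := (hV h).2.2.2
    simp at this
  have h2 : ∀ z, ![z, 0] ∉ V := fun z h => by
    have := (hV h).2.2.1
    simp at this
  simp [windowPred, h1, h2]

/-- Membership in the image of a subset of a window. -/
theorem mem_image_strip_iff (q : O.Square) {x y : ℝ} (hx : x ∈ Icc (0 : ℝ) 1)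
    (hy : y ∈ Icc (0 : ℝ) 1) :
    O.pt q x y ∈ (fun w : Fin 2 → ℝ => O.strip s (w 0) (w 1)) '' V ↔ O.windowPred s V q x y := by
  have hr : ∀ q, ∀ b ∈ Icc (0 : ℝ) 1, O.windowPred s V q 1 b = O.windowPred s V (O.right q) 0 b :=
    fun q b _ => windowPred_right ha hV q b
  have hu : ∀ q, ∀ b ∈ Icc (0 : ℝ) 1, O.windowPred s V q b 1 = O.windowPred s V (O.up q) b 0 :=
    fun q b _ => windowPred_up hV q b
  constructor
  · rintro ⟨w, hw, h⟩
    -- The predicate descends to the surface, so it may be evaluated at any representative of the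
    -- point, here the one given by the strip.
    rw [← lift_pt _ hr hu q hx hy, ← h]
    beta_reduce
    obtain ⟨w0, w1, w2, w3⟩ := hV hw
    have e : w = ![w 0, w 1] := by ext i; fin_cases i <;> rfl
    rcases le_total (w 0) 1 with h1 | h1
    · rw [strip_of_le h1, lift_pt _ hr hu _ ⟨by linarith [ha.1], h1⟩ ⟨w2.le, w3.le⟩]
      exact Or.inl ⟨rfl, e ▸ hw⟩
    · rw [strip_of_ge h1, lift_pt _ hr hu _ ⟨by linarith, by linarith [ha.2]⟩ ⟨w2.le, w3.le⟩]
      refine Or.inr ⟨rfl, ?_⟩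
      rw [sub_add_cancel]
      exact e ▸ hw
  · rintro (⟨rfl, h⟩ | ⟨rfl, h⟩)
    · exact ⟨_, h, by simp [strip_of_le hx.2]⟩
    · refine ⟨_, h, ?_⟩
      have : (1 : ℝ) ≤ x + 1 := by linarith [hx.1]
      simp [strip_of_ge this]

omit hV in
theorem injOn_strip (s : O.Square) :
    InjOn (fun w : Fin 2 → ℝ => O.strip s (w 0) (w 1)) (window a) := by
  intro w hw v hv h
  obtain ⟨w0, w1, w2, w3⟩ := id hw
  obtain ⟨v0, v1, v2, v3⟩ := id hv
  have e : w = ![w 0, w 1] := by ext i; fin_cases i <;> rfl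
  have hmem : O.strip s (w 0) (w 1) ∈ (fun w : Fin 2 → ℝ => O.strip s (w 0) (w 1)) '' {v} :=
    ⟨v, rfl, h.symm⟩
  have hV : {v} ⊆ window a := singleton_subset_iff.2 hv
  rcases le_total (w 0) 1 with h1 | h1
  · rw [strip_of_le h1, mem_image_strip_iff ha hV _ ⟨by linarith [ha.1], h1⟩ ⟨w2.le, w3.le⟩] at hmem
    rcases hmem with ⟨-, h⟩ | ⟨-, h⟩
    · exact e.trans h
    · have := congrFun (mem_singleton_iff.1 h) 0
      simp at this
      linarith
  · rw [strip_of_ge h1, mem_image_strip_iff ha hV _ ⟨by linarith, by linarith [ha.2]⟩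
      ⟨w2.le, w3.le⟩] at hmem
    rcases hmem with ⟨-, h⟩ | ⟨-, h⟩
    · have := congrFun (mem_singleton_iff.1 h) 0
      simp at this
      linarith
    · rw [sub_add_cancel] at h
      exact e.trans h

theorem isOpen_image_strip (s : O.Square) (hVo : IsOpen V) :
    IsOpen ((fun w : Fin 2 → ℝ => O.strip s (w 0) (w 1)) '' V) := by
  rw [isOpen_iff_pt]
  intro q
  have e : {p : unitInterval × unitInterval |
      O.pt q p.1 p.2 ∈ (fun w : Fin 2 → ℝ => O.strip s (w 0) (w 1)) '' V} =
      {p | O.windowPred s V q p.1 p.2} :=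
    Set.ext fun p => mem_image_strip_iff ha hV q p.1.2 p.2.2
  rw [e]
  have c1 : Continuous fun p : unitInterval × unitInterval => (![(p.1 : ℝ), p.2] : Fin 2 → ℝ) :=
    continuous_pi fun i => by fin_cases i <;> simp <;> fun_prop
  have c2 : Continuous fun p : unitInterval × unitInterval =>
      (![(p.1 : ℝ) + 1, p.2] : Fin 2 → ℝ) :=
    continuous_pi fun i => by fin_cases i <;> simp <;> fun_prop
  exact IsOpen.union (isOpen_const.and (hVo.preimage c1)) (isOpen_const.and (hVo.preimage c2))

omit hV in
/-- The points in the interior of a window are regular. -/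
theorem isRegular_strip (s : O.Square) {x y : ℝ} (hx : a < x) (hx' : x < a + 1)
    (hy : y ∈ Ioo (0 : ℝ) 1) : O.IsRegular (O.strip s x y) := by
  let g : window a → O.Surface := fun w => O.strip s (w.1 0) (w.1 1)
  have hg : IsOpenEmbedding g := by
    refine .of_continuous_injective_isOpenMap ?_ ?_ ?_
    · exact ((O.continuous_strip s).comp (f := fun w : Fin 2 → ℝ => (w 0, w 1)) (by fun_prop)).comp
        continuous_subtype_val
    · exact fun w v h => Subtype.ext (injOn_strip ha s w.2 v.2 h)
    · intro V hV
      have h := isOpen_image_strip (V := Subtype.val '' V) ha (by simp) s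
        ((isOpen_window a).isOpenMap_subtype_val V hV)
      rwa [image_image] at h
  have hxy : ![x, y] ∈ window a := ⟨hx, hx', hy.1, hy.2⟩
  have : Nonempty (window a) := ⟨⟨_, hxy⟩⟩
  refine ⟨(hg.toOpenPartialHomeomorph g).symm.trans
    ((isOpen_window a).isOpenEmbedding_subtypeVal.toOpenPartialHomeomorph _), ?_, ?_⟩
  · intro z hz
    simp only [OpenPartialHomeomorph.trans_source, OpenPartialHomeomorph.symm_source,
      IsOpenEmbedding.toOpenPartialHomeomorph_target, mem_inter_iff] at hz
    obtain ⟨w, rfl⟩ := hz.1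
    have e : (hg.toOpenPartialHomeomorph g).symm (g w) = w :=
      (hg.toOpenPartialHomeomorph g).left_inv (by simp)
    obtain ⟨w0, w1, w2, w3⟩ := w.2
    simp only [OpenPartialHomeomorph.coe_trans, Function.comp_apply, e]
    rw [toTorus_strip _ _ ⟨by linarith [ha.1], by linarith [ha.2]⟩ ⟨w2.le, w3.le⟩]
    funext i
    fin_cases i <;> rfl
  · simp only [OpenPartialHomeomorph.trans_source, OpenPartialHomeomorph.symm_source,
      IsOpenEmbedding.toOpenPartialHomeomorph_target,
      IsOpenEmbedding.toOpenPartialHomeomorph_source, preimage_univ, inter_univ]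
    exact ⟨⟨_, hxy⟩, rfl⟩

end Strip

theorem isRegular_of_mem_Ioo (s : O.Square) {x y : ℝ} (hx : x ∈ Icc (0 : ℝ) 1)
    (hy : y ∈ Ioo (0 : ℝ) 1) : O.IsRegular (O.pt s x y) := by
  -- The window starting at 1/2 is centred on the common vertical edge; the window starting at 0 is
  -- the open square itself.
  have half : (1 / 2 : ℝ) ∈ Icc (0 : ℝ) 1 := by constructor <;> norm_num
  rcases hx.2.eq_or_lt with rfl | h
  · rw [← strip_of_le le_rfl]
    exact isRegular_strip half s (by norm_num) (by norm_num) hy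
  rcases hx.1.eq_or_lt with rfl | h'
  · have := O.pt_right (O.right.symm s) y
    rw [Equiv.apply_symm_apply] at this
    rw [← this, ← strip_of_le le_rfl]
    exact isRegular_strip half _ (by norm_num) (by norm_num) hy
  · rw [← strip_of_le hx.2]
    exact isRegular_strip (a := 0) (by simp) s h' (by simpa using h) hy

/-- Functions to the plane that are congruent modulo `ℤ²` differ locally by a constant. -/
theorem eventually_eq_add_of_coe_eq {α : Type*} [TopologicalSpace α] {g h : α → Fin 2 → ℝ}
    {x₀ : α} (hg : ContinuousAt g x₀) (hh : ContinuousAt h x₀)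
    (H : ∀ᶠ x in 𝓝 x₀, ∀ i, (g x i : UnitAddCircle) = h x i) :
    ∃ b : Fin 2 → ℝ, ∀ᶠ x in 𝓝 x₀, g x = h x + b := by
  refine ⟨g x₀ - h x₀, ?_⟩
  have hball := (hg.sub hh).eventually (Metric.ball_mem_nhds _ (zero_lt_one (α := ℝ)))
  have key : ∀ y, (∀ i, (g y i : UnitAddCircle) = h y i) → ∀ i, ∃ n : ℤ, (n : ℝ) = g y i - h y i := by
    intro y hy i
    have h' : ((g y i - h y i : ℝ) : UnitAddCircle) = 0 := by
      rw [AddCircle.coe_sub]; exact sub_eq_zero.2 (hy i)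
    obtain ⟨n, hn⟩ := (AddCircle.coe_eq_zero_iff (1 : ℝ)).1 h'
    exact ⟨n, by simpa using hn⟩
  filter_upwards [hball, H] with x hx hx1
  funext i
  obtain ⟨n, hn⟩ := key x hx1 i
  obtain ⟨m, hm⟩ := key x₀ H.self_of_nhds i
  have hd : dist (g x i - h x i) (g x₀ i - h x₀ i) < 1 :=
    lt_of_le_of_lt (dist_le_pi_dist (g x - h x) (g x₀ - h x₀) i) hx
  rw [← hn, ← hm, Real.dist_eq] at hd
  have : n = m := by
    have := Int.abs_lt_one_iff.1 (show |n - m| < 1 by exact_mod_cast hd)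
    omega
  subst this
  simp only [Pi.add_apply, Pi.sub_apply]
  linarith

/-- A corner shared by two squares at the same position is a singularity. -/
theorem not_isRegular_of_pt_eq {s s' : O.Square} (hne : s ≠ s') (h : O.pt s 0 0 = O.pt s' 0 0) :
    ¬ O.IsRegular (O.pt s 0 0) := by
  rintro ⟨φ, hφ, hmem⟩
  have c : ∀ q, Continuous fun t : ℝ => O.pt q t t := fun q =>
    (O.continuous_pt q).comp (f := fun t : ℝ => (t, t)) (by fun_prop)
  have hs : Tendsto (fun t : ℝ => O.pt s t t) (𝓝 0) (𝓝 (O.pt s 0 0)) := (c s).tendsto 0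
  have hs' : Tendsto (fun t : ℝ => O.pt s' t t) (𝓝 0) (𝓝 (O.pt s 0 0)) := h ▸ (c s').tendsto 0
  have hsrc := φ.open_source.mem_nhds hmem
  have hc := φ.continuousAt hmem
  have h1 := hs.eventually hsrc
  have h2 := hs'.eventually hsrc
  -- A chart at the common corner would send the two diagonals to paths congruent modulo ℤ² that
  -- agree at 0, hence to equal paths, against injectivity. The absolute value keeps the coordinates
  -- in [0, 1] on a two-sided neighbourhood of 0.
  let g : ℝ → Fin 2 → ℝ := fun t => φ (O.pt s |t| |t|)
  let g' : ℝ → Fin 2 → ℝ := fun t => φ (O.pt s' |t| |t|)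
  have habs : Tendsto (fun t : ℝ => |t|) (𝓝 0) (𝓝 0) := by
    simpa using (continuous_abs (G := ℝ)).tendsto 0
  have hg : ContinuousAt g 0 := by
    have := hc.tendsto.comp (hs.comp habs)
    simpa [ContinuousAt, g] using! this
  have hg' : ContinuousAt g' 0 := by
    have := hc.tendsto.comp (hs'.comp habs)
    simpa [ContinuousAt, g', ← h] using! this
  have hI : ∀ᶠ t : ℝ in 𝓝 0, |t| < 1 := habs.eventually (gt_mem_nhds one_pos)
  obtain ⟨b, hb⟩ := eventually_eq_add_of_coe_eq (g := g) (h := g') hg hg' (by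
    filter_upwards [habs.eventually h1, habs.eventually h2, hI] with t t1 t2 t3 i
    have e1 := congrFun (hφ _ t1) i
    have e2 := congrFun (hφ _ t2) i
    rw [toTorus_pt _ _ ⟨abs_nonneg t, t3.le⟩ ⟨abs_nonneg t, t3.le⟩] at e1 e2
    exact e1.trans e2.symm)
  have hb0 : b = 0 := by
    have := hb.self_of_nhds
    simpa [g, g', h] using this
  obtain ⟨t, ⟨ht, t1, t2, t3⟩, t0⟩ := (((hb.and ((habs.eventually h1).and
    ((habs.eventually h2).and hI))).filter_mono (nhdsWithin_le_nhds (s := Ioi 0))).and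
    self_mem_nhdsWithin).exists
  rw [hb0, add_zero] at ht
  have hI' : |t| ∈ Ioo (0 : ℝ) 1 := ⟨abs_pos.2 (ne_of_gt t0), t3⟩
  exact hne (O.pt_injective hI' hI' hI' hI' (φ.injOn t1 t2 ht))

theorem not_isRegular_corner {s : O.Square}
    (h : O.right (O.up (O.right.symm (O.up.symm s))) ≠ s) : ¬ O.IsRegular (O.pt s 0 0) :=
  O.not_isRegular_of_pt_eq h.symm (O.pt_corner s).symm

end SquareTiling

end

/-! ### Affine homeomorphisms from symmetries of the tiling -/

noncomputable section

open Set Filter Topology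

namespace SquareTiling

variable (O : SquareTiling)

section Affine

variable {O}

/-- `f` covers the linear map with matrix `A` on the torus. -/
def CoversLinear (f : O.Surface → O.Surface) (A : Matrix (Fin 2) (Fin 2) ℝ) : Prop :=
  ∀ z, ∀ v : Fin 2 → ℝ, (fun i => (v i : UnitAddCircle)) = O.toTorus z →
    (fun i => (A.mulVec v i : UnitAddCircle)) = O.toTorus (f z)

/-- A chart φ at x is carried to A ∘ φ ∘ f⁻¹, which again lifts the covering of the torus because f
covers A. -/
theorem CoversLinear.isRegular {f : O.Surface ≃ₜ O.Surface} {A B : Matrix (Fin 2) (Fin 2) ℝ}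
    (hf : CoversLinear f A) (hAB : A * B = 1) (hBA : B * A = 1) {x : O.Surface}
    (h : O.IsRegular x) : O.IsRegular (f x) := by
  obtain ⟨φ, hφ, hx⟩ := h
  let L : (Fin 2 → ℝ) ≃ₜ (Fin 2 → ℝ) :=
    { toFun := A.mulVec
      invFun := B.mulVec
      left_inv := fun v => by rw [Matrix.mulVec_mulVec, hBA, Matrix.one_mulVec]
      right_inv := fun v => by rw [Matrix.mulVec_mulVec, hAB, Matrix.one_mulVec]
      continuous_toFun := continuous_const.matrix_mulVec continuous_id
      continuous_invFun := continuous_const.matrix_mulVec continuous_id }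
  refine ⟨(f.symm.transOpenPartialHomeomorph φ).transHomeomorph L, fun z hz => ?_, ?_⟩
  · have hz' : f.symm z ∈ φ.source := hz
    have := hf _ _ (hφ _ hz')
    rwa [Homeomorph.apply_symm_apply] at this
  · change f.symm (f x) ∈ φ.source
    rwa [Homeomorph.symm_apply_apply]

/-- A homeomorphism that covers an automorphism of the torus is affine. -/
theorem CoversLinear.isAffineWithDerivative {f : O.Surface ≃ₜ O.Surface}
    {A B : Matrix (Fin 2) (Fin 2) ℝ} (hf : CoversLinear f A) (hg : CoversLinear f.symm B)
    (hAB : A * B = 1) (hBA : B * A = 1) : O.IsAffineWithDerivative f A := by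
  refine ⟨fun x => ⟨fun h => ?_, hf.isRegular hAB hBA⟩, fun φ ψ hφ hψ x₀ h₁ h₂ => ?_⟩
  · simpa using hg.isRegular hBA hAB h
  -- Both functions lift the same map to the torus.
  · refine eventually_eq_add_of_coe_eq (g := fun x => ψ (f x)) (h := fun x => A.mulVec (φ x))
      ((ψ.continuousAt h₂).comp f.continuous.continuousAt)
      ((continuous_const.matrix_mulVec continuous_id).continuousAt.comp (φ.continuousAt h₁)) ?_
    filter_upwards [φ.open_source.mem_nhds h₁,
      f.continuous.continuousAt.eventually (ψ.open_source.mem_nhds h₂)] with x hx hx' i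
    exact congrFun ((hψ _ hx').trans (hf _ _ (hφ _ hx)).symm) i

end Affine

section Shear

variable {O} (σ : Equiv.Perm O.Square) (hr : ∀ s, σ (O.right s) = O.right (σ s))
  (hu : ∀ s, σ (O.up s) = O.up (O.right (σ s)))

include hr in
theorem symm_right_comm (s : O.Square) : σ.symm (O.right s) = O.right (σ.symm s) := by
  rw [Equiv.symm_apply_eq, hr, Equiv.apply_symm_apply]

/-- The map `(x, y) ↦ (x + y, y)`. -/
def shear : O.Surface → O.Surface :=
  lift (fun s x y => O.strip (σ s) (x + y) y)
    (fun s y hy => by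
      rw [strip_of_ge (by linarith [hy.1]), strip_of_le (by linarith [hy.2]), hr]
      congr 1; ring)
    (fun s x hx => by
      -- The sheared upper edge of s lies on top of the right neighbour of σ s; this is what forces
      -- the form of `hu`.
      rw [strip_of_ge (by linarith [hx.1]), strip_of_le (by linarith [hx.2]), pt_up, hu]
      congr 1; ring)

/-- The map `(x, y) ↦ (x - y, y)`, the inverse of `shear`. -/
def unshear : O.Surface → O.Surface :=
  -- As x − y may be negative, the strip starts one square further left, which shifts the abscissa
  -- by 1.
  lift (fun s x y => O.strip (O.right.symm (σ.symm s)) (x - y + 1) y)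
    (fun s y hy => by
      rw [strip_of_ge (by linarith [hy.2]), strip_of_le (by linarith [hy.1]),
        symm_right_comm σ hr, Equiv.apply_symm_apply, Equiv.symm_apply_apply]
      congr 1; ring)
    (fun s x hx => by
      rw [strip_of_le (by linarith [hx.2]), strip_of_ge (by linarith [hx.1]), pt_up,
        Equiv.apply_symm_apply]
      congr 1
      · rw [Equiv.eq_symm_apply, hu, ← hr, Equiv.apply_symm_apply, Equiv.apply_symm_apply]
      · ring)

theorem continuous_shear : Continuous (shear σ hr hu) :=
  continuous_lift _ _ _ fun s => (O.continuous_strip (σ s)).comp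
    (f := fun p : ℝ × ℝ => (p.1 + p.2, p.2)) (by fun_prop)

theorem continuous_unshear : Continuous (unshear σ hr hu) :=
  continuous_lift _ _ _ fun s => (O.continuous_strip (O.right.symm (σ.symm s))).comp
    (f := fun p : ℝ × ℝ => (p.1 - p.2 + 1, p.2)) (by fun_prop)

theorem shear_pt (s : O.Square) {x y : ℝ} (hx : x ∈ Icc (0 : ℝ) 1) (hy : y ∈ Icc (0 : ℝ) 1) :
    shear σ hr hu (O.pt s x y) = O.strip (σ s) (x + y) y := lift_pt _ _ _ s hx hy

theorem unshear_pt (s : O.Square) {x y : ℝ} (hx : x ∈ Icc (0 : ℝ) 1) (hy : y ∈ Icc (0 : ℝ) 1) :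
    unshear σ hr hu (O.pt s x y) = O.strip (O.right.symm (σ.symm s)) (x - y + 1) y :=
  lift_pt _ _ _ s hx hy

/-- The shear as a homeomorphism. -/
def shearHomeo : O.Surface ≃ₜ O.Surface where
  toFun := shear σ hr hu
  invFun := unshear σ hr hu
  left_inv z := by
    obtain ⟨s, x, hx, y, hy, rfl⟩ := O.exists_eq_pt z
    rw [shear_pt _ _ _ _ hx hy]
    rcases le_total (x + y) 1 with h | h
    · rw [strip_of_le h, unshear_pt _ _ _ _ ⟨by linarith [hx.1, hy.1], h⟩ hy,
        strip_of_ge (by linarith [hx.1]), Equiv.apply_symm_apply, Equiv.symm_apply_apply]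
      congr 1; ring
    · rw [strip_of_ge h, unshear_pt _ _ _ _ ⟨by linarith, by linarith [hx.2, hy.2]⟩ hy,
        strip_of_le (by linarith [hx.2]), ← hr, Equiv.symm_apply_apply, Equiv.symm_apply_apply]
      congr 1; ring
  right_inv z := by
    obtain ⟨s, x, hx, y, hy, rfl⟩ := O.exists_eq_pt z
    rw [unshear_pt _ _ _ _ hx hy]
    rcases le_total (x - y + 1) 1 with h | h
    · rw [strip_of_le h, shear_pt _ _ _ _ ⟨by linarith [hx.1, hy.2], h⟩ hy,
        strip_of_ge (by linarith [hx.1]), ← hr, Equiv.apply_symm_apply, Equiv.apply_symm_apply]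
      congr 1; ring
    · rw [strip_of_ge h, shear_pt _ _ _ _ ⟨by linarith, by linarith [hx.2, hy.1]⟩ hy,
        strip_of_le (by linarith [hx.2]), Equiv.apply_symm_apply, Equiv.apply_symm_apply]
      congr 1; ring
  continuous_toFun := continuous_shear σ hr hu
  continuous_invFun := continuous_unshear σ hr hu

theorem coversLinear_shear : CoversLinear (shear σ hr hu) !![1, 1; 0, 1] := by
  intro z v hv
  obtain ⟨s, x, hx, y, hy, rfl⟩ := O.exists_eq_pt z
  rw [toTorus_pt _ _ hx hy] at hv
  rw [shear_pt _ _ _ _ hx hy, toTorus_strip _ _ ⟨by linarith [hx.1, hy.1],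
    by linarith [hx.2, hy.2]⟩ hy]
  have h0 := congrFun hv 0
  have h1 := congrFun hv 1
  funext i
  fin_cases i
  · simpa [Matrix.mulVec, Matrix.vecHead, Matrix.vecTail] using congrArg₂ (· + ·) h0 h1
  · simpa [Matrix.mulVec, Matrix.vecHead, Matrix.vecTail] using h1

theorem coversLinear_unshear : CoversLinear (unshear σ hr hu) !![1, -1; 0, 1] := by
  intro z v hv
  obtain ⟨s, x, hx, y, hy, rfl⟩ := O.exists_eq_pt z
  rw [toTorus_pt _ _ hx hy] at hv
  rw [unshear_pt _ _ _ _ hx hy, toTorus_strip _ _ ⟨by linarith [hx.1, hy.2],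
    by linarith [hx.2, hy.1]⟩ hy]
  have h0 := congrFun hv 0
  have h1 := congrFun hv 1
  have hp : ((1 : ℝ) : UnitAddCircle) = 0 := AddCircle.coe_period 1
  funext i
  fin_cases i
  · simpa [Matrix.mulVec, Matrix.vecHead, Matrix.vecTail, hp, sub_eq_add_neg] using
      congrArg₂ (· - ·) h0 h1
  · simpa [Matrix.mulVec, Matrix.vecHead, Matrix.vecTail] using h1

include hr hu in
theorem exists_isAffine_shear : ∃ f, O.IsAffineWithDerivative f !![1, 1; 0, 1] :=
  ⟨shearHomeo σ hr hu, CoversLinear.isAffineWithDerivative (B := !![1, -1; 0, 1])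
    (coversLinear_shear σ hr hu) (coversLinear_unshear σ hr hu)
    (by simp [Matrix.one_fin_two]) (by simp [Matrix.one_fin_two])⟩

end Shear

section Rotation

variable {O} (σ : Equiv.Perm O.Square) (hr : ∀ s, σ (O.right s) = O.up (σ s))
  (hu : ∀ s, σ s = O.right (σ (O.up s)))

/-- The map `(x, y) ↦ (1 - y, x)`. -/
def rotate : O.Surface → O.Surface :=
  lift (fun s x y => O.pt (σ s) (1 - y) x)
    (fun s y _ => by rw [pt_up, hr])
    (fun s x _ => by rw [hu, sub_self, sub_zero, pt_right])

/-- The map `(x, y) ↦ (y, 1 - x)`, the inverse of `rotate`. -/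
def unrotate : O.Surface → O.Surface :=
  lift (fun s x y => O.pt (σ.symm s) y (1 - x))
    (fun s y _ => by
      rw [sub_self, sub_zero, pt_up]
      congr 1
      rw [Equiv.symm_apply_eq]
      apply O.right.injective
      rw [← hu, Equiv.apply_symm_apply])
    (fun s x _ => by
      rw [pt_right]
      congr 1
      rw [Equiv.eq_symm_apply, hr, Equiv.apply_symm_apply])

theorem rotate_pt (s : O.Square) {x y : ℝ} (hx : x ∈ Icc (0 : ℝ) 1) (hy : y ∈ Icc (0 : ℝ) 1) :
    rotate σ hr hu (O.pt s x y) = O.pt (σ s) (1 - y) x := lift_pt _ _ _ s hx hy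

theorem unrotate_pt (s : O.Square) {x y : ℝ} (hx : x ∈ Icc (0 : ℝ) 1) (hy : y ∈ Icc (0 : ℝ) 1) :
    unrotate σ hr hu (O.pt s x y) = O.pt (σ.symm s) y (1 - x) := lift_pt _ _ _ s hx hy

/-- The rotation as a homeomorphism. -/
def rotateHomeo : O.Surface ≃ₜ O.Surface where
  toFun := rotate σ hr hu
  invFun := unrotate σ hr hu
  left_inv z := by
    obtain ⟨s, x, hx, y, hy, rfl⟩ := O.exists_eq_pt z
    rw [rotate_pt _ _ _ _ hx hy, unrotate_pt _ _ _ _ ⟨by linarith [hy.2], by linarith [hy.1]⟩ hx,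
      Equiv.symm_apply_apply, sub_sub_cancel]
  right_inv z := by
    obtain ⟨s, x, hx, y, hy, rfl⟩ := O.exists_eq_pt z
    rw [unrotate_pt _ _ _ _ hx hy, rotate_pt _ _ _ _ hy ⟨by linarith [hx.2], by linarith [hx.1]⟩,
      Equiv.apply_symm_apply, sub_sub_cancel]
  continuous_toFun := continuous_lift _ _ _ fun s => (O.continuous_pt (σ s)).comp
    (f := fun p : ℝ × ℝ => (1 - p.2, p.1)) (by fun_prop)
  continuous_invFun := continuous_lift _ _ _ fun s => (O.continuous_pt (σ.symm s)).comp
    (f := fun p : ℝ × ℝ => (p.2, 1 - p.1)) (by fun_prop)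

theorem coversLinear_rotate : CoversLinear (rotate σ hr hu) !![0, -1; 1, 0] := by
  intro z v hv
  obtain ⟨s, x, hx, y, hy, rfl⟩ := O.exists_eq_pt z
  rw [toTorus_pt _ _ hx hy] at hv
  rw [rotate_pt _ _ _ _ hx hy, toTorus_pt _ _ ⟨by linarith [hy.2], by linarith [hy.1]⟩ hx]
  have h0 := congrFun hv 0
  have h1 := congrFun hv 1
  have hp : ((1 : ℝ) : UnitAddCircle) = 0 := AddCircle.coe_period 1
  funext i
  fin_cases i
  · simpa [Matrix.mulVec, Matrix.vecHead, Matrix.vecTail, hp] using congrArg Neg.neg h1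
  · simpa [Matrix.mulVec, Matrix.vecHead, Matrix.vecTail] using h0

theorem coversLinear_unrotate : CoversLinear (unrotate σ hr hu) !![0, 1; -1, 0] := by
  intro z v hv
  obtain ⟨s, x, hx, y, hy, rfl⟩ := O.exists_eq_pt z
  rw [toTorus_pt _ _ hx hy] at hv
  rw [unrotate_pt _ _ _ _ hx hy, toTorus_pt _ _ hy ⟨by linarith [hx.2], by linarith [hx.1]⟩]
  have h0 := congrFun hv 0
  have h1 := congrFun hv 1
  have hp : ((1 : ℝ) : UnitAddCircle) = 0 := AddCircle.coe_period 1
  funext i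
  fin_cases i
  · simpa [Matrix.mulVec, Matrix.vecHead, Matrix.vecTail] using h1
  · simpa [Matrix.mulVec, Matrix.vecHead, Matrix.vecTail, hp] using congrArg Neg.neg h0

theorem isRegular_rotate {z : O.Surface} (hz : O.IsRegular z) :
    O.IsRegular (rotate σ hr hu z) :=
  CoversLinear.isRegular (f := rotateHomeo σ hr hu) (B := !![0, 1; -1, 0])
    (coversLinear_rotate σ hr hu) (by simp [Matrix.one_fin_two]) (by simp [Matrix.one_fin_two]) hz

include hr hu in
theorem exists_isAffine_rotation : ∃ f, O.IsAffineWithDerivative f !![0, -1; 1, 0] :=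
  ⟨rotateHomeo σ hr hu, CoversLinear.isAffineWithDerivative (B := !![0, 1; -1, 0])
    (coversLinear_rotate σ hr hu) (coversLinear_unrotate σ hr hu)
    (by simp [Matrix.one_fin_two]) (by simp [Matrix.one_fin_two])⟩

include hr hu in
/-- On a tiling with rotational symmetry all points except the vertices are regular. -/
theorem isRegular_of_toTorus_ne_zero {z : O.Surface} (hz : O.toTorus z ≠ 0) : O.IsRegular z := by
  obtain ⟨s, x, hx, y, hy, rfl⟩ := O.exists_eq_pt z
  have hp : ((1 : ℝ) : UnitAddCircle) = 0 := AddCircle.coe_period 1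
  by_cases hy' : y ∈ Ioo (0 : ℝ) 1
  · exact O.isRegular_of_mem_Ioo s hx hy'
  have hy2 : y = 0 ∨ y = 1 := by
    by_contra! h
    exact hy' ⟨hy.1.lt_of_ne' h.1, hy.2.lt_of_ne h.2⟩
  have hx' : x ∈ Ioo (0 : ℝ) 1 := by
    by_contra h
    have hx2 : x = 0 ∨ x = 1 := by
      by_contra! h'
      exact h ⟨hx.1.lt_of_ne' h'.1, hx.2.lt_of_ne h'.2⟩
    apply hz
    rw [toTorus_pt _ _ hx hy]
    funext i
    rcases hx2 with rfl | rfl <;> rcases hy2 with rfl | rfl <;> fin_cases i <;> simp [hp]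
  -- A point inside a horizontal edge is the rotated image of a point inside a vertical edge, where
  -- a window is available.
  have h := isRegular_rotate σ hr hu (O.isRegular_of_mem_Ioo (σ.symm s) (x := y) hy
    (y := 1 - x) ⟨by linarith [hx'.2], by linarith [hx'.1]⟩)
  rwa [rotate_pt _ _ _ _ hy ⟨by linarith [hx.2], by linarith [hx.1]⟩, Equiv.apply_symm_apply,
    sub_sub_cancel] at h

end Rotation

/-! ### Integrality of derivatives and the Veech group criterion -/

section Edge

variable {O}

/-- If `γ` is a straight segment with holonomy `e` between singularities over the origin, then
the derivative of an affine homeomorphism maps `e` to an integer vector. -/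
theorem exists_int_of_segment {f : O.Surface ≃ₜ O.Surface} {A : Matrix (Fin 2) (Fin 2) ℝ}
    (hf : O.IsAffineWithDerivative f A)
    (hsing : ∀ z, ¬ O.IsRegular z → O.toTorus z = 0) {γ : ℝ → O.Surface} (hγ : Continuous γ)
    (e : Fin 2 → ℝ)
    (he : ∀ t ∈ Ioo (0 : ℝ) 1, (fun i => ((t • e) i : UnitAddCircle)) = O.toTorus (γ t))
    (hreg : ∀ t ∈ Ioo (0 : ℝ) 1, O.IsRegular (γ t))
    (h0 : ¬ O.IsRegular (γ 0)) (h1 : ¬ O.IsRegular (γ 1)) :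
    ∀ i, ∃ n : ℤ, A.mulVec e i = n := by
  -- The discrepancy on the torus between the image path and the linear path t ↦ A(t e). It is
  -- locally constant wherever γ is regular, since f is affine in charts there.
  let δ : ℝ → Fin 2 → UnitAddCircle := fun t i =>
    O.toTorus (f (γ t)) i - ((A.mulVec (t • e) i : ℝ) : UnitAddCircle)
  have hA : Continuous fun t : ℝ => A.mulVec (t • e) :=
    continuous_const.matrix_mulVec (continuous_id.smul continuous_const)
  have hδ : Continuous δ := by
    refine continuous_pi fun i => Continuous.sub
      ((continuous_apply i).comp (O.continuous_toTorus.comp (f.continuous.comp hγ)))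
      ((AddCircle.continuous_mk' 1).comp ((continuous_pi_iff.1 hA) i))
  have hloc : ∀ t ∈ Ioo (0 : ℝ) 1, ∀ᶠ t' in 𝓝 t, δ t' = δ t := by
    intro t ht
    obtain ⟨φ, hφ, h₁⟩ := hreg t ht
    obtain ⟨ψ, hψ, h₂⟩ := (hf.1 _).2 (hreg t ht)
    obtain ⟨b, hb⟩ := hf.2 φ ψ hφ hψ _ h₁ h₂
    have hφγ : ContinuousAt (fun t => φ (γ t)) t :=
      (φ.continuousAt h₁).comp hγ.continuousAt
    obtain ⟨c, hc⟩ := eventually_eq_add_of_coe_eq (g := fun t => φ (γ t)) (h := fun t => t • e)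
      hφγ (by fun_prop) (by
        filter_upwards [hγ.continuousAt.eventually (φ.open_source.mem_nhds h₁),
          Ioo_mem_nhds ht.1 ht.2] with t' h ht' i
        exact congrFun ((hφ _ h).trans (he t' ht').symm) i)
    have key : ∀ᶠ t' in 𝓝 t, δ t' = fun i => (((A.mulVec c + b) i : ℝ) : UnitAddCircle) := by
      filter_upwards [hγ.continuousAt.eventually hb, hc,
        (f.continuous.comp hγ).continuousAt.eventually (ψ.open_source.mem_nhds h₂)] with t' e1 e2 e3
      funext i
      have := congrFun (hψ _ e3) i
      simp only [δ]
      rw [Function.comp_apply] at this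
      rw [← this, ← AddCircle.coe_sub, e1, e2, Matrix.mulVec_add]
      congr 1
      simp only [Pi.add_apply]
      ring
    filter_upwards [key] with t' h
    rw [h, key.self_of_nhds]
  have hconst : ∀ t ∈ Ioo (0 : ℝ) 1, δ t = δ (1 / 2) := by
    intro t ht
    exact isPreconnected_Ioo.induction₂ (fun a b => δ a = δ b)
      (fun a ha => (hloc a ha).filter_mono nhdsWithin_le_nhds |>.mono fun _ h => h.symm)
      (fun _ _ _ _ _ _ h h' => h.trans h') (fun _ _ _ _ h => h.symm) ht (by constructor <;> norm_num)
  -- Continuity carries constancy to the singular endpoints, where no chart exists.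
  have hcl : ∀ t ∈ Icc (0 : ℝ) 1, δ t = δ (1 / 2) := by
    have h : EqOn δ (fun _ => δ (1 / 2)) (Ioo 0 1) := hconst
    have := h.closure hδ continuous_const
    rw [closure_Ioo zero_ne_one] at this
    exact this
  intro i
  -- Both endpoints of the image path are singular, so lie over the origin: δ 0 = 0 and δ 1 = −A e
  -- modulo ℤ².
  have h := congrFun ((hcl 1 (by simp)).trans (hcl 0 (by simp)).symm) i
  simp only [δ, hsing _ (mt (hf.1 _).1 h0), hsing _ (mt (hf.1 _).1 h1), one_smul, zero_smul,
    Matrix.mulVec_zero, Pi.zero_apply] at h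
  have h' : ((A.mulVec e i : ℝ) : UnitAddCircle) = 0 := by simpa using h
  obtain ⟨n, hn⟩ := (AddCircle.coe_eq_zero_iff (1 : ℝ)).1 h'
  exact ⟨n, by simpa using hn.symm⟩

/-- If some horizontal and some vertical edge join singularities, then the derivatives of affine
homeomorphisms are integer matrices. -/
theorem exists_int_of_isAffineWithDerivative {f : O.Surface ≃ₜ O.Surface}
    {A : Matrix (Fin 2) (Fin 2) ℝ} (hf : O.IsAffineWithDerivative f A)
    (hreg : ∀ z, O.toTorus z ≠ 0 → O.IsRegular z) {s t : O.Square}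
    (hs : ¬ O.IsRegular (O.pt s 0 0)) (hs' : ¬ O.IsRegular (O.pt (O.right s) 0 0))
    (ht : ¬ O.IsRegular (O.pt t 0 0)) (ht' : ¬ O.IsRegular (O.pt (O.up t) 0 0)) (i j : Fin 2) :
    ∃ n : ℤ, A i j = n := by
  have hsing : ∀ z, ¬ O.IsRegular z → O.toTorus z = 0 := fun z hz => by
    by_contra h
    exact hz (hreg z h)
  have hne : ∀ x ∈ Ioo (0 : ℝ) 1, (x : UnitAddCircle) ≠ 0 := by
    intro x hx h
    obtain ⟨n, hn⟩ := (AddCircle.coe_eq_zero_iff (1 : ℝ)).1 h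
    simp only [zsmul_eq_mul, mul_one] at hn
    rw [← hn] at hx
    have h1 : (0 : ℤ) < n := by exact_mod_cast hx.1
    have h2 : n < (1 : ℤ) := by exact_mod_cast hx.2
    omega
  fin_cases j
  · have hT : ∀ t ∈ Ioo (0 : ℝ) 1, O.toTorus (O.pt s t 0) =
        fun i => ((t • (![1, 0] : Fin 2 → ℝ)) i : UnitAddCircle) := fun t ht => by
      rw [toTorus_pt _ _ (Ioo_subset_Icc_self ht) (by simp)]
      funext i
      fin_cases i <;> simp
    obtain ⟨n, hn⟩ := exists_int_of_segment hf hsing (γ := fun t => O.pt s t 0)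
      ((O.continuous_pt s).comp (f := fun t : ℝ => (t, (0 : ℝ))) (by fun_prop)) ![1, 0]
      (fun t ht => (hT t ht).symm)
      (fun t ht => hreg _ fun h => hne t ht (by simpa [hT t ht] using congrFun h 0))
      hs (by rwa [pt_right]) i
    exact ⟨n, by rw [← hn]; simp [Matrix.mulVec, dotProduct]⟩
  · have hT : ∀ x ∈ Ioo (0 : ℝ) 1, O.toTorus (O.pt t 0 x) =
        fun i => ((x • (![0, 1] : Fin 2 → ℝ)) i : UnitAddCircle) := fun x hx => by
      rw [toTorus_pt _ _ (by simp) (Ioo_subset_Icc_self hx)]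
      funext i
      fin_cases i <;> simp
    obtain ⟨n, hn⟩ := exists_int_of_segment hf hsing (γ := fun x => O.pt t 0 x)
      ((O.continuous_pt t).comp (f := fun x : ℝ => ((0 : ℝ), x)) (by fun_prop)) ![0, 1]
      (fun x hx => (hT x hx).symm)
      (fun x hx => hreg _ fun h => hne x hx (by simpa [hT x hx] using congrFun h 1))
      ht (by rwa [pt_up]) i
    exact ⟨n, by rw [← hn]; simp [Matrix.mulVec, dotProduct]⟩

end Edge

theorem mapGL_mem_veechGroup (g : SL(2, ℤ))
    (h : ∃ f, O.IsAffineWithDerivative f ((g : Matrix (Fin 2) (Fin 2) ℤ).map Int.cast)) :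
    Matrix.SpecialLinearGroup.mapGL ℝ g ∈ O.veechGroup := by
  refine ⟨?_, h⟩
  change 0 < ((g : Matrix (Fin 2) (Fin 2) ℤ).map (Int.cast : ℤ → ℝ)).det
  rw [← Int.cast_det, g.2]
  simp

/-- A criterion for the Veech group to be `SL₂(ℤ)`: the tiling has the symmetries that lift the
two standard generators, and a horizontal and a vertical edge join singularities. -/
theorem veechGroup_eq_range (σ τ : Equiv.Perm O.Square)
    (hσr : ∀ s, σ (O.right s) = O.right (σ s)) (hσu : ∀ s, σ (O.up s) = O.up (O.right (σ s)))
    (hτr : ∀ s, τ (O.right s) = O.up (τ s)) (hτu : ∀ s, τ s = O.right (τ (O.up s)))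
    {s t : O.Square}
    (hs : O.right (O.up (O.right.symm (O.up.symm s))) ≠ s)
    (hs' : O.right (O.up (O.right.symm (O.up.symm (O.right s)))) ≠ O.right s)
    (ht : O.right (O.up (O.right.symm (O.up.symm t))) ≠ t)
    (ht' : O.right (O.up (O.right.symm (O.up.symm (O.up t)))) ≠ O.up t) :
    O.veechGroup = (Matrix.SpecialLinearGroup.mapGL ℝ : SL(2, ℤ) →* GL (Fin 2) ℝ).range := by
  have hint : ∀ A ∈ O.veechGroup, ∃ M : Matrix (Fin 2) (Fin 2) ℤ,
      (A : Matrix (Fin 2) (Fin 2) ℝ) = M.map (Int.cast : ℤ → ℝ) := by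
    rintro A ⟨-, f, hf⟩
    choose M hM using exists_int_of_isAffineWithDerivative hf
      (fun z hz => isRegular_of_toTorus_ne_zero τ hτr hτu hz)
      (O.not_isRegular_corner hs) (O.not_isRegular_corner hs')
      (O.not_isRegular_corner ht) (O.not_isRegular_corner ht')
    exact ⟨M, Matrix.ext hM⟩
  apply le_antisymm
  · intro A hA
    obtain ⟨M, hM⟩ := hint A hA
    -- Integrality of the inverse as well makes det M a unit of ℤ.
    obtain ⟨N, hN⟩ := hint A⁻¹ (inv_mem hA)
    have hd : ∀ M : Matrix (Fin 2) (Fin 2) ℤ, (M.map (Int.cast : ℤ → ℝ)).det = M.det := fun M =>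
      (Int.cast_det M).symm
    have hmul : (M.det : ℝ) * N.det = 1 := by
      rw [← hd, ← hd, ← hM, ← hN, ← Matrix.det_mul, ← Units.val_mul, mul_inv_cancel, Units.val_one,
        Matrix.det_one]
    have hpos : (0 : ℝ) < M.det := by
      rw [← hd, ← hM]
      exact hA.1
    have hdet : M.det = 1 :=
      Int.eq_one_of_mul_eq_one_right (by exact_mod_cast hpos.le) (by exact_mod_cast hmul)
    refine ⟨⟨M, hdet⟩, Units.ext ?_⟩
    rw [hM]
    rfl
  · rw [MonoidHom.range_eq_map, ← SpecialLinearGroup.SL2Z_generators, MonoidHom.map_closure,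
      Subgroup.closure_le]
    rintro _ ⟨g, rfl | rfl, rfl⟩
    · refine O.mapGL_mem_veechGroup _ ?_
      convert exists_isAffine_rotation τ hτr hτu using 3
      ext i j
      fin_cases i <;> fin_cases j <;> simp [ModularGroup.S]
    · refine O.mapGL_mem_veechGroup _ ?_
      convert exists_isAffine_shear σ hσr hσu using 3
      ext i j
      fin_cases i <;> fin_cases j <;> simp [ModularGroup.T]

end SquareTiling

end

/-! ### PΓ₂/PΓ₆ as `SL₂(𝔽₃)` modulo ±1, and a numbering of the squares of X -/

noncomputable section

/-- The quotient map from `Γ₂` onto `PΓ₂ / PΓ₆`. -/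
def gammaQuotMap : CongruenceSubgroup.Gamma 2 →* PGammaQuot :=
  (QuotientGroup.mk' _).comp
    (((QuotientGroup.mk' (Subgroup.center SL(2, ℤ))).comp (Subgroup.subtype _)).codRestrict
      (PGamma 2) fun g => Subgroup.mem_map_of_mem _ g.2)

theorem gammaQuotMap_surjective : Function.Surjective gammaQuotMap := by
  intro a
  obtain ⟨⟨_, g, hg, rfl⟩, rfl⟩ := QuotientGroup.mk_surjective a
  exact ⟨⟨g, hg⟩, rfl⟩

/-- Reduction modulo `3`. -/
def redThree : CongruenceSubgroup.Gamma 2 →* SL(2, ZMod 3) :=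
  (Matrix.SpecialLinearGroup.map (Int.castRingHom (ZMod 3))).comp (Subgroup.subtype _)

theorem mem_center_SL2Z_iff {g : SL(2, ℤ)} :
    g ∈ Subgroup.center SL(2, ℤ) ↔ g = 1 ∨ g = -1 := by
  rw [Matrix.SpecialLinearGroup.mem_center_iff]
  constructor
  · rintro ⟨r, hr, h⟩
    rw [Fintype.card_fin, sq_eq_one_iff] at hr
    rcases hr with rfl | rfl
    · left
      apply Subtype.ext
      rw [← h]
      simp
    · right
      apply Subtype.ext
      rw [← h]
      simp
  · rintro (rfl | rfl)
    · exact ⟨1, by simp, by simp⟩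
    · exact ⟨-1, by simp, by simp⟩

theorem mem_gamma_six_iff {g : SL(2, ℤ)} (hg : g ∈ CongruenceSubgroup.Gamma 2) :
    g ∈ CongruenceSubgroup.Gamma 6 ↔ g ∈ CongruenceSubgroup.Gamma 3 := by
  have key : ∀ (N : ℕ) (a b : ℤ), (a : ZMod N) = b ↔ (N : ℤ) ∣ b - a := fun N a b =>
    ZMod.intCast_eq_intCast_iff_dvd_sub a b N
  have k0 := fun N a => key N a 0
  have k1 := fun N a => key N a 1
  simp only [Int.cast_zero, Int.cast_one] at k0 k1
  simp only [CongruenceSubgroup.Gamma_mem, k0, k1] at hg ⊢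
  push_cast at hg ⊢
  omega

/-- Passing to `PSL₂(ℤ)` enlarges the kernel from Γ₆ to ±Γ₆. Inside Γ₂, which contains −1, belonging
to Γ₆ is a condition modulo 3 only. -/
theorem gammaQuotMap_eq_one_iff (g : CongruenceSubgroup.Gamma 2) :
    gammaQuotMap g = 1 ↔ redThree g = 1 ∨ redThree g = -1 := by
  have hneg : (-1 : SL(2, ℤ)) ∈ CongruenceSubgroup.Gamma 2 := by
    rw [CongruenceSubgroup.Gamma_mem]; decide
  have hred : ∀ h : CongruenceSubgroup.Gamma 2,
      redThree h = 1 ↔ (h : SL(2, ℤ)) ∈ CongruenceSubgroup.Gamma 6 := fun h => by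
    rw [mem_gamma_six_iff h.2]
    rfl
  have hmul : redThree (⟨-1, hneg⟩ * g) = - redThree g := by
    rw [map_mul]
    have : redThree ⟨-1, hneg⟩ = -1 := by
      ext i j
      simp [redThree, Matrix.one_apply]
    rw [this, neg_one_mul]
  rw [← neg_eq_iff_eq_neg (a := redThree g), ← hmul, hred, hred]
  have h1 : gammaQuotMap g = 1 ↔
      (QuotientGroup.mk' (Subgroup.center SL(2, ℤ))) g ∈ PGamma 6 := by
    exact QuotientGroup.eq_one_iff _
  rw [h1, PGamma, Subgroup.mem_map]
  constructor
  · rintro ⟨k, hk, h⟩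
    rw [QuotientGroup.mk'_eq_mk'] at h
    obtain ⟨z, hz, h⟩ := h
    rcases mem_center_SL2Z_iff.1 hz with rfl | rfl
    · left
      rwa [← h, mul_one]
    · right
      rw [Subgroup.coe_mul, ← h]
      simpa using hk
  · rintro (h | h)
    · exact ⟨g, h, rfl⟩
    · refine ⟨_, h, ?_⟩
      rw [QuotientGroup.mk'_eq_mk']
      exact ⟨-1, mem_center_SL2Z_iff.2 (Or.inr rfl), by simp⟩

theorem gammaQuotMap_eq_iff (g h : CongruenceSubgroup.Gamma 2) :
    gammaQuotMap g = gammaQuotMap h ↔ redThree g = redThree h ∨ redThree g = -redThree h := by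
  rw [← mul_inv_eq_one, ← map_inv, ← map_mul, gammaQuotMap_eq_one_iff, map_mul, map_inv,
    mul_inv_eq_one, mul_inv_eq_iff_eq_mul, neg_one_mul]

/-- Representatives of the elements of `PΓ₂ / PΓ₆`. -/
def gammaRep : Fin 12 → CongruenceSubgroup.Gamma 2 :=
  let x : CongruenceSubgroup.Gamma 2 := ⟨xMat, xMat_mem⟩
  let y : CongruenceSubgroup.Gamma 2 := ⟨yMat, yMat_mem⟩
  ![1, x, y, x * x, x * y, y * x, y * y, x * x * y, x * y * y, y * x * x, y * y * x,
    x * y * y * x]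

/-- Right multiplication by `x` on the representatives. -/
def mulX : Fin 12 → Fin 12 := ![1, 3, 5, 0, 6, 9, 10, 8, 11, 2, 4, 7]

/-- Right multiplication by `y` on the representatives. -/
def mulY : Fin 12 → Fin 12 := ![2, 4, 6, 7, 8, 3, 0, 5, 1, 11, 9, 10]

/-- The matrices of the representatives modulo `3`. -/
def redRep : Fin 12 → Matrix (Fin 2) (Fin 2) (ZMod 3) :=
  ![!![1, 0; 0, 1], !![1, 2; 0, 1], !![1, 0; 2, 1], !![1, 1; 0, 1], !![2, 2; 2, 1], !![1, 2; 2, 2],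
    !![1, 0; 1, 1], !![0, 1; 2, 1], !![0, 2; 1, 1], !![1, 1; 2, 0], !![1, 2; 1, 0], !![0, 2; 1, 0]]

/-- The matrix of `x` modulo `3`. -/
def redX : Matrix (Fin 2) (Fin 2) (ZMod 3) := !![1, 2; 0, 1]

/-- The matrix of `y` modulo `3`. -/
def redY : Matrix (Fin 2) (Fin 2) (ZMod 3) := !![1, 0; 2, 1]

theorem coe_redThree_gammaRep (i : Fin 12) :
    (redThree (gammaRep i) : Matrix (Fin 2) (Fin 2) (ZMod 3)) = redRep i := by
  have hx : (redThree ⟨xMat, xMat_mem⟩ : Matrix (Fin 2) (Fin 2) (ZMod 3)) = redX := by decide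
  have hy : (redThree ⟨yMat, yMat_mem⟩ : Matrix (Fin 2) (Fin 2) (ZMod 3)) = redY := by decide
  fin_cases i <;>
    simp [gammaRep, hx, hy] <;> decide

/-- The classes of the representatives. -/
def rep (i : Fin 12) : PGammaQuot := gammaQuotMap (gammaRep i)

/-- This reduces every equation in the quotient group to a decidable one between matrices over 𝔽₃.
-/
theorem gammaQuotMap_eq_rep_iff (g : CongruenceSubgroup.Gamma 2) (i : Fin 12) :
    gammaQuotMap g = rep i ↔ (redThree g : Matrix (Fin 2) (Fin 2) (ZMod 3)) = redRep i ∨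
      (redThree g : Matrix (Fin 2) (Fin 2) (ZMod 3)) = -redRep i := by
  rw [rep, gammaQuotMap_eq_iff, ← coe_redThree_gammaRep, ← Matrix.SpecialLinearGroup.coe_neg]
  exact or_congr Subtype.ext_iff Subtype.ext_iff

theorem rep_injective : Function.Injective rep := by
  intro i j h
  rw [rep, gammaQuotMap_eq_rep_iff, coe_redThree_gammaRep] at h
  revert i j
  decide +kernel

theorem rep_surjective : Function.Surjective rep := by
  intro a
  obtain ⟨g, rfl⟩ := gammaQuotMap_surjective a
  -- Up to sign, the twelve representatives exhaust the matrices of determinant 1 over 𝔽₃.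
  have key : ∀ a b c d : ZMod 3, a * d - b * c = 1 →
      ∃ i, !![a, b; c, d] = redRep i ∨ !![a, b; c, d] = -redRep i := by
    decide +kernel
  have hd := (redThree g).2
  rw [Matrix.det_fin_two] at hd
  obtain ⟨i, hi⟩ := key _ _ _ _ hd
  rw [← Matrix.eta_fin_two] at hi
  exact ⟨i, ((gammaQuotMap_eq_rep_iff g i).2 hi).symm⟩

theorem rep_mul_xQ (i : Fin 12) : rep i * xQ = rep (mulX i) := by
  change gammaQuotMap (gammaRep i) * gammaQuotMap (gammaRep 1) = _
  rw [← map_mul, gammaQuotMap_eq_rep_iff, map_mul, Matrix.SpecialLinearGroup.coe_mul, coe_redThree_gammaRep,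
    coe_redThree_gammaRep]
  revert i
  decide +kernel

theorem rep_mul_yQ (i : Fin 12) : rep i * yQ = rep (mulY i) := by
  change gammaQuotMap (gammaRep i) * gammaQuotMap (gammaRep 2) = _
  rw [← map_mul, gammaQuotMap_eq_rep_iff, map_mul, Matrix.SpecialLinearGroup.coe_mul, coe_redThree_gammaRep,
    coe_redThree_gammaRep]
  revert i
  decide +kernel

/-- Right multiplication by `x⁻¹` on the representatives. -/
def mulXInv : Fin 12 → Fin 12 := ![3, 0, 9, 1, 10, 2, 4, 11, 7, 5, 6, 8]

/-- Right multiplication by `y⁻¹` on the representatives. -/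
def mulYInv : Fin 12 → Fin 12 := ![6, 8, 0, 5, 1, 7, 2, 3, 4, 10, 11, 9]

theorem rep_mul_xQ_inv (i : Fin 12) : rep i * xQ⁻¹ = rep (mulXInv i) := by
  rw [mul_inv_eq_iff_eq_mul, rep_mul_xQ]
  congr 1
  revert i
  decide

theorem rep_mul_yQ_inv (i : Fin 12) : rep i * yQ⁻¹ = rep (mulYInv i) := by
  rw [mul_inv_eq_iff_eq_mul, rep_mul_yQ]
  congr 1
  revert i
  decide

theorem rep_zero : rep 0 = 1 := map_one gammaQuotMap

/-- The squares of `X`, numbered. -/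
def squareEquiv : Fin 12 × Fin 4 ≃ PGammaQuot × Fin 4 :=
  (Equiv.ofBijective rep ⟨rep_injective, rep_surjective⟩).prodCongr (Equiv.refl _)

/-- The right neighbour, in terms of the numbering. -/
def rightIdx : Fin 12 × Fin 4 → Fin 12 × Fin 4
  | (a, 0) => (a, 1)
  | (a, 1) => (mulYInv a, 0)
  | (a, 2) => (a, 3)
  | (a, 3) => (mulY a, 2)

/-- The upper neighbour, in terms of the numbering. -/
def upIdx : Fin 12 × Fin 4 → Fin 12 × Fin 4
  | (a, 0) => (mulY a, 2)
  | (a, 1) => (mulYInv a, 3)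
  | (a, 2) => (mulXInv a, 0)
  | (a, 3) => (mulX a, 1)

/-- The drift, in terms of the numbering. -/
def driftIdx (p : Fin 12 × Fin 4) : ℤ :=
  -- Since x and y have order 3 in the quotient, the indices 10, 6, 2, 9 stand for y⁻¹x, y⁻¹, y,
  -- yx⁻¹.
  if p = (10, 2) ∨ p = (6, 0) ∨ p = (2, 2) ∨ p = (9, 0) then 1
  else if p = (10, 0) ∨ p = (6, 2) ∨ p = (2, 0) ∨ p = (9, 2) then -1
  else 0

theorem right_squareEquiv (p : Fin 12 × Fin 4) :
    origamiX.right (squareEquiv p) = squareEquiv (rightIdx p) := by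
  obtain ⟨a, h⟩ := p
  fin_cases h
  · rfl
  · exact Prod.ext (rep_mul_yQ_inv a) rfl
  · rfl
  · exact Prod.ext (rep_mul_yQ a) rfl

theorem up_squareEquiv (p : Fin 12 × Fin 4) :
    origamiX.up (squareEquiv p) = squareEquiv (upIdx p) := by
  obtain ⟨a, h⟩ := p
  fin_cases h
  · exact Prod.ext (rep_mul_yQ a) rfl
  · exact Prod.ext (rep_mul_yQ_inv a) rfl
  · exact Prod.ext (rep_mul_xQ_inv a) rfl
  · exact Prod.ext (rep_mul_xQ a) rfl

theorem slitDrift_squareEquiv (p : Fin 12 × Fin 4) : slitDrift (squareEquiv p) = driftIdx p := by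
  have h2 : yQ = rep 2 := by rw [← one_mul yQ, ← rep_zero, rep_mul_yQ]; rfl
  have h6 : yQ⁻¹ = rep 6 := by rw [← one_mul yQ⁻¹, ← rep_zero, rep_mul_yQ_inv]; rfl
  have h10 : yQ⁻¹ * xQ = rep 10 := by rw [h6, rep_mul_xQ]; rfl
  have h9 : yQ * xQ⁻¹ = rep 9 := by rw [h2, rep_mul_xQ_inv]; rfl
  have e : ∀ (i : Fin 12) (h : Fin 4), squareEquiv p = (rep i, h) ↔ p = (i, h) := fun i h =>
    squareEquiv.injective.eq_iff (a := p) (b := (i, h))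
  rw [slitDrift, driftIdx, h10, h9, h6, h2]
  simp only [e]

end

/-! ### Lifting the symmetries of X to the cyclic cover -/

noncomputable section

namespace SquareTiling

variable {O : SquareTiling} {n : ℕ} [NeZero n] {d : O.Square → ℤ}

/-- The permutation `(s, j) ↦ (τ s, c s - j)` of the squares of a cyclic cover. -/
def coverPerm (n : ℕ) [NeZero n] (d : O.Square → ℤ) (τ : Equiv.Perm O.Square) (c : O.Square → ℤ) :
    Equiv.Perm (O.cyclicCover n d).Square where
  toFun s := (τ s.1, (c s.1 : ZMod n) - s.2)
  invFun s := (τ.symm s.1, (c (τ.symm s.1) : ZMod n) - s.2)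
  left_inv s := Prod.ext (by simp) (by simp)
  right_inv s := Prod.ext (by simp) (by simp)

/-- The lift inverts the deck group ℤ/n, so it respects the gluing when σ pulls the cocycle back to
−d + δc. A step to the right goes to a step to the right; a step upwards goes to a step to the right
followed by one upwards, of cocycle value d (σ s). -/
theorem coverPerm_shear {σ : Equiv.Perm O.Square} {c : O.Square → ℤ}
    (hr : ∀ s, σ (O.right s) = O.right (σ s)) (hu : ∀ s, σ (O.up s) = O.up (O.right (σ s)))
    (hcr : ∀ s, c (O.right s) - d s = c s + d (σ s)) (hcu : ∀ s, c (O.up s) = c s + d (σ s)) :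
    (∀ s, coverPerm n d σ c ((O.cyclicCover n d).right s) =
      (O.cyclicCover n d).right (coverPerm n d σ c s)) ∧
    ∀ s, coverPerm n d σ c ((O.cyclicCover n d).up s) =
      (O.cyclicCover n d).up ((O.cyclicCover n d).right (coverPerm n d σ c s)) := by
  refine ⟨fun s => Prod.ext (hr s.1) ?_, fun s => Prod.ext (hu s.1) ?_⟩
  · have h := congrArg (Int.cast : ℤ → ZMod n) (hcr s.1)
    push_cast at h
    change (c (O.right s.1) : ZMod n) - (s.2 + d s.1) = c s.1 - s.2 + d (σ s.1)
    linear_combination h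
  · have h := congrArg (Int.cast : ℤ → ZMod n) (hcu s.1)
    push_cast at h
    change (c (O.up s.1) : ZMod n) - s.2 = c s.1 - s.2 + d (σ s.1)
    linear_combination h

/-- The same cocycle condition: a step to the right becomes a step upwards, of value 0, and a step
upwards becomes a step to the left, of value −d (τ (up s)). -/
theorem coverPerm_rotation {τ : Equiv.Perm O.Square} {c : O.Square → ℤ}
    (hr : ∀ s, τ (O.right s) = O.up (τ s)) (hu : ∀ s, τ s = O.right (τ (O.up s)))
    (hcr : ∀ s, c (O.right s) = c s + d s) (hcu : ∀ s, c s = c (O.up s) + d (τ (O.up s))) :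
    (∀ s, coverPerm n d τ c ((O.cyclicCover n d).right s) =
      (O.cyclicCover n d).up (coverPerm n d τ c s)) ∧
    ∀ s, coverPerm n d τ c s =
      (O.cyclicCover n d).right (coverPerm n d τ c ((O.cyclicCover n d).up s)) := by
  refine ⟨fun s => Prod.ext (hr s.1) ?_, fun s => Prod.ext (hu s.1) ?_⟩
  · have h := congrArg (Int.cast : ℤ → ZMod n) (hcr s.1)
    push_cast at h
    change (c (O.right s.1) : ZMod n) - (s.2 + d s.1) = c s.1 - s.2
    linear_combination h
  · have h := congrArg (Int.cast : ℤ → ZMod n) (hcu s.1)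
    push_cast at h
    change (c s.1 : ZMod n) - s.2 = c (O.up s.1) - s.2 + d (τ (O.up s.1))
    linear_combination h

end SquareTiling

/-- The permutation of the numbered squares of `X` that lifts the shear. -/
def shearIdx : Fin 12 × Fin 4 → Fin 12 × Fin 4
  | (a, 0) => (mulYInv a, 1)
  | (a, 1) => (mulY a, 0)
  | (a, 2) => (mulY a, 2)
  | (a, 3) => (mulY a, 3)

/-- The permutation of the numbered squares of `X` that lifts the rotation. -/
def rotationIdx : Fin 12 × Fin 4 → Fin 12 × Fin 4
  | (a, 0) => (mulXInv a, 2)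
  | (a, 1) => (mulX a, 0)
  | (a, 2) => (mulX a, 3)
  | (a, 3) => (mulXInv a, 1)

/-- The translation between the copies of `X` that accompanies the shear. -/
def shearShift (p : Fin 12 × Fin 4) : ℤ :=
  if p ∈ ([(0, 2), (2, 1), (6, 0), (6, 3), (9, 0), (9, 3), (10, 1), (11, 2)] :
    List (Fin 12 × Fin 4)) then -1 else 0

/-- The translation between the copies of `X` that accompanies the rotation. -/
def rotationShift (p : Fin 12 × Fin 4) : ℤ :=
  if p ∈ ([(2, 0), (2, 3), (6, 1), (6, 2), (9, 1), (9, 2), (10, 0), (10, 3)] :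
    List (Fin 12 × Fin 4)) then 1 else 0

/-- A permutation of the squares of `X` given in terms of the numbering. -/
def permOfIdx (f : Fin 12 × Fin 4 → Fin 12 × Fin 4) (hf : Function.Injective f) :
    Equiv.Perm origamiX.Square :=
  squareEquiv.permCongr (Equiv.ofBijective f (Finite.injective_iff_bijective.1 hf))

theorem permOfIdx_squareEquiv {f : Fin 12 × Fin 4 → Fin 12 × Fin 4} (hf : Function.Injective f)
    (p : Fin 12 × Fin 4) : permOfIdx f hf (squareEquiv p) = squareEquiv (f p) := by
  change squareEquiv (f (squareEquiv.symm (squareEquiv p))) = _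
  rw [Equiv.symm_apply_apply]

theorem forall_square {P : origamiX.Square → Prop} (h : ∀ p, P (squareEquiv p)) (s) : P s := by
  obtain ⟨p, rfl⟩ := squareEquiv.surjective s
  exact h p

theorem shearIdx_injective : Function.Injective shearIdx := by
  decide +kernel

theorem rotationIdx_injective : Function.Injective rotationIdx := by
  decide +kernel

/-- The gluing of X multiplies A on the right only, so left translations are automorphisms of X, and
composing with them gives further lifts of the shear. The lift `shearIdx` is one that sends d to −d
up to a coboundary; `shearShift` is a primitive of that coboundary. -/
theorem exists_perm_shear (n : ℕ) [NeZero n] :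
    ∃ σ : Equiv.Perm (origamiX.cyclicCover n slitDrift).Square,
      (∀ s, σ ((origamiX.cyclicCover n slitDrift).right s) =
        (origamiX.cyclicCover n slitDrift).right (σ s)) ∧
      ∀ s, σ ((origamiX.cyclicCover n slitDrift).up s) =
        (origamiX.cyclicCover n slitDrift).up ((origamiX.cyclicCover n slitDrift).right (σ s)) := by
  refine ⟨_, SquareTiling.coverPerm_shear (σ := permOfIdx shearIdx shearIdx_injective)
    (c := fun s => shearShift (squareEquiv.symm s)) (forall_square fun p => ?_)
    (forall_square fun p => ?_) (forall_square fun p => ?_) (forall_square fun p => ?_)⟩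
  · simp only [permOfIdx_squareEquiv, right_squareEquiv]
    congr 1
    revert p
    decide +kernel
  · simp only [permOfIdx_squareEquiv, right_squareEquiv, up_squareEquiv]
    congr 1
    revert p
    decide +kernel
  · simp only [permOfIdx_squareEquiv, right_squareEquiv, slitDrift_squareEquiv,
      Equiv.symm_apply_apply]
    revert p
    decide +kernel
  · simp only [permOfIdx_squareEquiv, up_squareEquiv, slitDrift_squareEquiv,
      Equiv.symm_apply_apply]
    revert p
    decide +kernel

theorem exists_perm_rotation (n : ℕ) [NeZero n] :
    ∃ τ : Equiv.Perm (origamiX.cyclicCover n slitDrift).Square,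
      (∀ s, τ ((origamiX.cyclicCover n slitDrift).right s) =
        (origamiX.cyclicCover n slitDrift).up (τ s)) ∧
      ∀ s, τ s =
        (origamiX.cyclicCover n slitDrift).right (τ ((origamiX.cyclicCover n slitDrift).up s)) := by
  refine ⟨_, SquareTiling.coverPerm_rotation (τ := permOfIdx rotationIdx rotationIdx_injective)
    (c := fun s => rotationShift (squareEquiv.symm s)) (forall_square fun p => ?_)
    (forall_square fun p => ?_) (forall_square fun p => ?_) (forall_square fun p => ?_)⟩
  · simp only [permOfIdx_squareEquiv, right_squareEquiv, up_squareEquiv]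
    congr 1
    revert p
    decide +kernel
  · simp only [permOfIdx_squareEquiv, right_squareEquiv, up_squareEquiv]
    congr 1
    revert p
    decide +kernel
  · simp only [right_squareEquiv, slitDrift_squareEquiv, Equiv.symm_apply_apply]
    revert p
    decide +kernel
  · simp only [permOfIdx_squareEquiv, up_squareEquiv, slitDrift_squareEquiv,
      Equiv.symm_apply_apply]
    revert p
    decide +kernel

/-- The projection to X commutes with all neighbour maps, so a full turn that fails to close up in X
fails to close up in the cover. -/
theorem corner_fst_ne {n : ℕ} [NeZero n] {s : (origamiX.cyclicCover n slitDrift).Square}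
    (h : origamiX.right (origamiX.up (origamiX.right.symm (origamiX.up.symm s.1))) ≠ s.1) :
    (origamiX.cyclicCover n slitDrift).right ((origamiX.cyclicCover n slitDrift).up
      ((origamiX.cyclicCover n slitDrift).right.symm
        ((origamiX.cyclicCover n slitDrift).up.symm s))) ≠ s :=
  fun e => h (congrArg Prod.fst e)

theorem corner_squareEquiv_ne {p q : Fin 12 × Fin 4} (hpq : upIdx (rightIdx q) = p)
    (h : rightIdx (upIdx q) ≠ p) :
    origamiX.right (origamiX.up (origamiX.right.symm (origamiX.up.symm (squareEquiv p)))) ≠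
      squareEquiv p := by
  have e : origamiX.right.symm (origamiX.up.symm (squareEquiv p)) = squareEquiv q :=
    (Equiv.symm_apply_eq _).2 ((Equiv.symm_apply_eq _).2
      (by rw [right_squareEquiv, up_squareEquiv, hpq]))
  rw [e, up_squareEquiv, right_squareEquiv]
  exact fun h' => h (squareEquiv.injective h')

end
/-- The Veech group of `Y` is `SL₂(ℤ)`, embedded in `GL₂(ℝ)`. -/
theorem mainTheorem6 (k : ℕ) [NeZero k] :
    (origamiY k).veechGroup = (Matrix.SpecialLinearGroup.mapGL ℝ : SL(2, ℤ) →* GL (Fin 2) ℝ).range := by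
  obtain ⟨σ, hσr, hσu⟩ := exists_perm_shear (2 * k)
  obtain ⟨τ, hτr, hτu⟩ := exists_perm_rotation (2 * k)
  refine (origamiX.cyclicCover (2 * k) slitDrift).veechGroup_eq_range σ τ hσr hσu hτr hτu
    -- The edges used are the lower edge of the square (1, 1) and the left edge of (1, 2) of X, in
    -- the copy 0. Below, q is the square diagonally below and to the left of the corner in
    -- question.
    (s := (squareEquiv (0, 0), 0)) (t := (squareEquiv (0, 1), 0))
    (corner_fst_ne ?_) (corner_fst_ne ?_) (corner_fst_ne ?_) (corner_fst_ne ?_)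
  · exact corner_squareEquiv_ne (q := (8, 3)) (by decide) (by decide)
  · change origamiX.right (origamiX.up (origamiX.right.symm (origamiX.up.symm
      (origamiX.right (squareEquiv (0, 0)))))) ≠ origamiX.right (squareEquiv (0, 0))
    rw [right_squareEquiv]
    exact corner_squareEquiv_ne (q := (3, 2)) (by decide) (by decide)
  · exact corner_squareEquiv_ne (q := (3, 2)) (by decide) (by decide)
  · change origamiX.right (origamiX.up (origamiX.right.symm (origamiX.up.symm
      (origamiX.up (squareEquiv (0, 1)))))) ≠ origamiX.up (squareEquiv (0, 1))
    rw [up_squareEquiv]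
    exact corner_squareEquiv_ne (q := (0, 0)) (by decide) (by decide)
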